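/- Let $E$ be a real Banach space with norm $|\cdot|$ and let $P\subset E$ be a cone, i.e. a closed convex set with $\lambda x\in P$ for all $x\in P$, $\lambda\ge 0$, with $P\cap(-P)=\{0\}$ and $P\neq\{0\}$. Let $b:P\times P\to P$ be bilinear (additive and positively homogeneous in each variable) and compact (continuous, and mapping bounded subsets of $P\times P$ to relatively compact sets). Let $|b|$ be the least constant $B\ge 0$ such that $|b(u,v)|\le B|u||v|$ for all $u,v\in P$. Suppose that $b$ is coercive, i.e. $$\inf_{u\in P,\ |u|=1}|b(u,u)|>0.$$ Then for every $u_0\in P$ with $4|b||u_0|<1$ the equation $$u=b(u,u)+u_0$$ has at least two distinct solutions $u\in P$. -/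

import Mathlib

/-- Bilinear forms `P × P → P` on a cone `P`. A closed convex cone is a module over the semiring of
nonnegative reals, and bilinearity is bilinearity over that semiring: `b` is additive and
positively homogeneous in each of its two variables. It takes its values in `P`. -/
abbrev ConeBilinForm {E : Type*} [NormedAddCommGroup E] [NormedSpace ℝ E]
    (P : ProperCone ℝ E) : Type _ :=
  P →ₗ[{r : ℝ // 0 ≤ r}] P →ₗ[{r : ℝ // 0 ≤ r}] P

namespace ConeBilinForm

/-- Compactness of the (nonlinear) map `b : P × P → P`, in the usual sense of nonlinear functional
analysis: it is (jointly) continuous and maps bounded sets to relatively compact sets. -/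
def IsCompactForm {E : Type*} [NormedAddCommGroup E] [NormedSpace ℝ E]
    {P : ProperCone ℝ E} (b : ConeBilinForm P) : Prop :=
  Continuous (fun p : P × P => b p.1 p.2) ∧
    ∀ S : Set (P × P), Bornology.IsBounded S →
      IsCompact (closure ((fun p : P × P => (b p.1 p.2 : E)) '' S))

/-- The norm `|b|`: the least `B ≥ 0` with `|b(u,v)| ≤ B |u| |v|` for all `u, v ∈ P`. -/
noncomputable def formNorm {E : Type*} [NormedAddCommGroup E] [NormedSpace ℝ E]
    {P : ProperCone ℝ E} (b : ConeBilinForm P) : ℝ :=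
  sInf {B : ℝ | 0 ≤ B ∧ ∀ u v : P, ‖(b u v : E)‖ ≤ B * ‖(u : E)‖ * ‖(v : E)‖}

/-- Coercivity: `inf {|b(u,u)| : u ∈ P, |u| = 1} > 0`. -/
def IsCoerciveForm {E : Type*} [NormedAddCommGroup E] [NormedSpace ℝ E]
    {P : ProperCone ℝ E} (b : ConeBilinForm P) : Prop :=
  0 < sInf ((fun u : P => ‖(b u u : E)‖) '' {u : P | ‖(u : E)‖ = 1})

end ConeBilinForm

/-! One solution `v` comes from Schauder's theorem: `4|b||u₀| < 1` makes `u ↦ b(u,u) + u₀` preserve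
the part of `P` in the ball of radius `2|u₀|`. A second one is sought as `v + w`. Then `w = L w +
b(w,w)` with `L w = b(v,w) + b(w,v)`, and `|L w| ≤ 4|b||u₀||w|`, so the Neumann series gives `S = (1
- L)⁻¹`, which maps `P` to `P`. The equation becomes `w = S b(w,w)`, whose right side is homogeneous
of degree two. It therefore suffices to find a unit vector `x` with `S b(x,x) = n x`, `n > 0`, and
to take `w = x / n`. Such an `x` is a fixed point of a normalised map
(`ProperCone.exists_eigenvector`): coercivity keeps `S b(x,x)` away from zero on the unit sphere,
and salience prevents cancellation in the cone. Schauder's theorem is deduced from Brouwer's, and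
Brouwer's from the Milnor–Rogers volume argument. -/

/-! ### Brouwer's theorem by volumes and determinants -/

open Set Metric MeasureTheory Filter Topology in
theorem ContinuousLinearMap.det_one_add_pos {F : Type*} [NormedAddCommGroup F] [NormedSpace ℝ F]
    [FiniteDimensional ℝ F] {A : F →L[ℝ] F} (hA : ‖A‖ < 1) : 0 < (1 + A).det := by
  by_contra! hneg
  have hcont : Continuous fun s : ℝ => (1 + s • A).det :=
    ContinuousLinearMap.continuous_det.comp (by fun_prop)
  -- The determinant is `1` at `s = 0`, so it would vanish at some `s ≤ 1`; a kernel vector then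
  -- satisfies `v = -s A v`, against `‖A‖ < 1`.
  obtain ⟨s, ⟨hs0, hs1⟩, hs⟩ : (0 : ℝ) ∈ (fun s : ℝ => (1 + s • A).det) '' Icc 0 1 := by
    refine intermediate_value_Icc' zero_le_one hcont.continuousOn ⟨by simpa using hneg, ?_⟩
    simp [ContinuousLinearMap.det]
  obtain ⟨v, hv0, hv⟩ : ∃ v : F, v ≠ 0 ∧ (1 + s • A) v = 0 := by
    have h := LinearMap.bot_lt_ker_of_det_eq_zero (f := ((1 + s • A : F →L[ℝ] F) : F →ₗ[ℝ] F)) hs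
    obtain ⟨v, hv, hv0⟩ := (Submodule.ne_bot_iff _).1 h.ne'
    exact ⟨v, hv0, hv⟩
  have hv' : v = -(s • A v) := by
    rw [eq_neg_iff_add_eq_zero]
    simpa using hv
  have hlt : ‖v‖ < ‖v‖ := by
    calc ‖v‖ = s * ‖A v‖ := by
          conv_lhs => rw [hv']
          rw [norm_neg, norm_smul, Real.norm_of_nonneg hs0]
      _ ≤ 1 * ‖A v‖ := by gcongr
      _ ≤ ‖A‖ * ‖v‖ := by rw [one_mul]; exact A.le_opNorm v
      _ < 1 * ‖v‖ := by
          gcongr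
      _ = ‖v‖ := one_mul _
  exact lt_irrefl _ hlt

/-- `det (1 + t A)` is a polynomial in `t`. -/
theorem ContinuousLinearMap.exists_polynomial_det_one_add_smul {F : Type*} [NormedAddCommGroup F]
    [NormedSpace ℝ F] [FiniteDimensional ℝ F] (A : F →L[ℝ] F) :
    ∃ p : Polynomial ℝ, p.natDegree ≤ Module.finrank ℝ F ∧
      ∀ t : ℝ, p.eval t = (1 + t • A).det := by
  classical
  let e := Module.finBasis ℝ F
  let M := LinearMap.toMatrix e e (A : F →ₗ[ℝ] F)
  refine ⟨_, (Polynomial.natDegree_det_X_add_C_le M 1).trans (by simp), fun t => ?_⟩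
  have h : (1 + t • A).det = (t • M + 1).det := by
    rw [ContinuousLinearMap.det, ← LinearMap.det_toMatrix e]
    congr 1
    rw [add_comm]
    simp [M]
  rw [h, ← Polynomial.coe_evalRingHom, RingHom.map_det]
  congr 1
  ext i j
  by_cases hij : i = j <;> simp [hij] <;> ring

/-- Values at `t = 1` of the polynomials `det (1 + t A)` are a fixed weighted mean of the values at
finitely many small `t`. -/
theorem exists_weights_det_one_add_smul (F : Type*) [NormedAddCommGroup F]
    [NormedSpace ℝ F] [FiniteDimensional ℝ F] {δ : ℝ} (hδ : 0 < δ) :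
    ∃ (s : Finset ℝ) (w : ℝ → ℝ), (∀ t ∈ s, 0 < t ∧ t < δ) ∧ ∑ t ∈ s, w t = 1 ∧
      ∀ A : F →L[ℝ] F, ∑ t ∈ s, w t * (1 + t • A).det = (1 + A).det := by
  -- `finrank + 1` nodes determine a polynomial of degree at most `finrank`; the weights are the
  -- Lagrange basis values at `1`, independent of `A`.
  obtain ⟨s, hs, hcard⟩ := (Set.Ioo_infinite hδ).exists_subset_card_eq (Module.finrank ℝ F + 1)
  have hinj : Set.InjOn (id : ℝ → ℝ) s := Function.injective_id.injOn
  have hne : s.Nonempty := Finset.card_pos.1 (by omega)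
  refine ⟨s, fun t => (Lagrange.basis s id t).eval 1, fun t ht => hs ht, ?_, fun A => ?_⟩
  · rw [← Polynomial.eval_finsetSum, Lagrange.sum_basis hinj hne, Polynomial.eval_one]
  · obtain ⟨p, hdeg, hp⟩ := A.exists_polynomial_det_one_add_smul
    have hlt : p.degree < s.card := by
      rw [hcard]
      exact (Polynomial.degree_le_of_natDegree_le hdeg).trans_lt (by exact_mod_cast Nat.lt_succ_self _)
    have h1 := congrArg (Polynomial.eval 1) (Lagrange.eq_interpolate hinj hlt)
    rw [Lagrange.interpolate_apply, Polynomial.eval_finsetSum, hp, one_smul] at h1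
    rw [h1]
    refine Finset.sum_congr rfl fun t _ => ?_
    rw [Polynomial.eval_mul, Polynomial.eval_C, id, hp, mul_comm]

open Set Metric MeasureTheory Filter Topology in
/-- There is no `C¹` retraction of the closed unit ball onto the unit sphere. -/
theorem not_exists_contDiff_retraction_sphere {F : Type*} [NormedAddCommGroup F]
    [InnerProductSpace ℝ F] [FiniteDimensional ℝ F] (r : F → F)
    (hr : ∀ x ∈ closedBall (0 : F) 1, ContDiffAt ℝ 1 r x)
    (hr_norm : ∀ x ∈ closedBall (0 : F) 1, ‖r x‖ = 1)
    (hr_sphere : ∀ x ∈ sphere (0 : F) 1, r x = x) : False := by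
  let _ : MeasurableSpace F := borel F
  have _ : BorelSpace F := ⟨rfl⟩
  set B := closedBall (0 : F) 1 with hB
  set U := ball (0 : F) 1 with hU
  have hUB : U ⊆ B := ball_subset_closedBall
  have hBc : IsCompact B := isCompact_closedBall 0 1
  set g : F → F := fun x => r x - x with hg
  have hgc : ∀ x ∈ B, ContDiffAt ℝ 1 g x := fun x hx => (hr x hx).sub contDiffAt_id
  set g' : F → F →L[ℝ] F := fderiv ℝ g with hg'
  have hg'c : ContinuousOn g' B := fun x hx =>
    ((hgc x hx).fderiv_right (m := 0) le_rfl).continuousAt.continuousWithinAt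
  obtain ⟨C, hC⟩ := hBc.exists_bound_of_continuousOn hg'c
  have hC0 : 0 ≤ C := (norm_nonneg _).trans (hC 0 (by simp [hB]))
  have hlip : ∀ x ∈ B, ∀ y ∈ B, ‖g y - g x‖ ≤ C * ‖y - x‖ := fun x hx y hy =>
    (convex_closedBall (0 : F) 1).norm_image_sub_le_of_norm_fderiv_le
      (fun z hz => (hgc z hz).differentiableAt one_ne_zero) hC hx hy
  -- volumes of the images under `id + t g` for small `t`
  have key : ∀ t : ℝ, 0 < t ∧ t < (C + 1)⁻¹ →
      ∫ x in U, (1 + t • g' x).det = volume.real U := by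
    rintro t ⟨ht0, ht⟩
    have htC : t * C < 1 := by
      have h1 : t * (C + 1) < 1 := by
        rwa [lt_inv_comm₀ ht0 (by positivity), lt_inv_comm₀ (by positivity) ht0,
          ← one_div, lt_div_iff₀ (by positivity)] at ht
      nlinarith
    have ht1 : t < 1 := ht.trans_le (inv_le_one_of_one_le₀ (by linarith))
    -- `h` is `(1 - t) id + t r`; for small `t` it is a diffeomorphism of the open ball onto itself.
    set h : F → F := fun x => x + t • g x with hh
    have hstrict : ∀ x ∈ B, HasStrictFDerivAt h (1 + t • g' x) x := fun x hx =>
      (hasStrictFDerivAt_id x).add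
        (((hgc x hx).hasStrictFDerivAt one_ne_zero).const_smul t)
    have hpos : ∀ x ∈ B, 0 < (1 + t • g' x).det := fun x hx => by
      apply ContinuousLinearMap.det_one_add_pos
      rw [norm_smul, Real.norm_of_nonneg ht0.le]
      exact (mul_le_mul_of_nonneg_left (hC x hx) ht0.le).trans_lt htC
    have hinj : InjOn h B := by
      intro x hx y hy hxy
      by_contra hne
      have h1 : y - x = -(t • (g y - g x)) := by
        simp only [hh] at hxy
        rw [smul_sub, neg_sub, sub_eq_sub_iff_add_eq_add, add_comm (t • g x) x, hxy]
      have h2 : 0 < ‖y - x‖ := norm_pos_iff.2 (sub_ne_zero.2 (Ne.symm hne))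
      have h3 : ‖y - x‖ ≤ t * (C * ‖y - x‖) := by
        calc ‖y - x‖ = t * ‖g y - g x‖ := by
              rw [h1, norm_neg, norm_smul, Real.norm_of_nonneg ht0.le]
          _ ≤ t * (C * ‖y - x‖) := by gcongr; exact hlip x hx y hy
      nlinarith
    have himg_sub : h '' U ⊆ U := by
      rintro _ ⟨x, hx, rfl⟩
      have hx1 : ‖x‖ < 1 := by simpa [hU] using hx
      have h1 : h x = (1 - t) • x + t • r x := by
        simp only [hh, hg]; module
      have : ‖h x‖ < 1 := by
        calc ‖h x‖ ≤ ‖(1 - t) • x‖ + ‖t • r x‖ := h1 ▸ norm_add_le _ _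
          _ = (1 - t) * ‖x‖ + t := by
              rw [norm_smul, norm_smul, hr_norm x (hUB hx), Real.norm_of_nonneg ht0.le,
                Real.norm_of_nonneg (by linarith), mul_one]
          _ < 1 := by nlinarith
      simpa [hU] using this
    have himg_open : IsOpen (h '' U) := by
      rw [isOpen_iff_mem_nhds]
      rintro _ ⟨x, hx, rfl⟩
      have hs : HasStrictFDerivAt h
          (((1 + t • g' x).toContinuousLinearEquivOfDetNeZero (hpos x (hUB hx)).ne' :
            F ≃L[ℝ] F) : F →L[ℝ] F) x := by
        simpa using hstrict x (hUB hx)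
      rw [← hs.map_nhds_eq_of_equiv]
      exact image_mem_map (isOpen_ball.mem_nhds hx)
    have hclosed : IsClosed (h '' B) :=
      (hBc.image_of_continuousOn fun x hx =>
        (hstrict x hx).continuousAt.continuousWithinAt).isClosed
    have hsph : h '' B ∩ U ⊆ h '' U := by
      rintro _ ⟨⟨x, hx, rfl⟩, hxU⟩
      rcases (mem_closedBall_zero_iff.1 hx).lt_or_eq with hlt | heq
      · exact ⟨x, by simpa [hU] using hlt, rfl⟩
      · have : h x = x := by simp [hh, hg, hr_sphere x (by simpa using heq)]
        rw [this] at hxU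
        simp [hU, heq] at hxU
    -- The image is open, and relatively closed in `U` because `h` fixes the sphere; `U` is
    -- connected.
    have himg : h '' U = U := by
      refine himg_sub.antisymm ?_
      have hconn : IsPreconnected U := (convex_ball (0 : F) 1).isPreconnected
      have hcov : U ⊆ h '' U ∪ (h '' B)ᶜ := fun y hy => by
        by_cases hyB : y ∈ h '' B
        · exact Or.inl (hsph ⟨hyB, hy⟩)
        · exact Or.inr hyB
      have h0 : (0 : F) ∈ U := by simp [hU]
      refine hconn.subset_left_of_subset_union himg_open hclosed.isOpen_compl ?_ hcov
        ⟨h 0, himg_sub (mem_image_of_mem h h0), mem_image_of_mem h h0⟩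
      exact disjoint_compl_right.mono_left (image_mono hUB)
    have hcv := integral_image_eq_integral_abs_det_fderiv_smul volume measurableSet_ball
      (fun x hx => (hstrict x (hUB hx)).hasFDerivAt.hasFDerivWithinAt) (hinj.mono hUB)
      (fun _ => (1 : ℝ))
    rw [← hU, himg] at hcv
    simp only [smul_eq_mul, mul_one, integral_const, measureReal_restrict_apply_univ] at hcv
    rw [hcv]
    exact setIntegral_congr_fun measurableSet_ball fun x hx => (abs_of_pos (hpos x (hUB hx))).symm
  -- The volume identity is known only for small `t`; polynomial dependence on `t` carries it to `t
  -- = 1`, where `1 + g'` is the derivative of `r`.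
  obtain ⟨s, w, hs, hw, hdet⟩ :=
    exists_weights_det_one_add_smul F (δ := (C + 1)⁻¹) (by positivity)
  have hint : ∀ t : ℝ, IntegrableOn (fun x => (1 + t • g' x).det) U := fun t =>
    (ContinuousOn.integrableOn_compact hBc
      (ContinuousLinearMap.continuous_det.comp_continuousOn
        (continuousOn_const.add (hg'c.const_smul t)))).mono_set hUB
  have hvol : ∫ x in U, (1 + g' x).det = volume.real U := by
    calc ∫ x in U, (1 + g' x).det = ∫ x in U, ∑ t ∈ s, w t * (1 + t • g' x).det := by
          simp_rw [hdet]
      _ = ∑ t ∈ s, w t * ∫ x in U, (1 + t • g' x).det := by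
          rw [integral_finsetSum _ fun t _ => (hint t).const_mul (w t)]
          simp_rw [integral_const_mul]
      _ = volume.real U := by
          rw [Finset.sum_congr rfl fun t ht => by rw [key t (hs t ht)], ← Finset.sum_mul, hw, one_mul]
  -- Since `‖r‖ = 1` on `U`, the range of the derivative is orthogonal to `r x`, so it is not
  -- surjective.
  have hzero : ∀ x ∈ U, (1 + g' x).det = 0 := by
    intro x hx
    have hrd : HasFDerivAt r (1 + g' x) x := by
      have := (hasFDerivAt_id (𝕜 := ℝ) x).add
        ((hgc x (hUB hx)).differentiableAt one_ne_zero).hasFDerivAt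
      refine this.congr_of_eventuallyEq (Eventually.of_forall fun y => ?_)
      simp [hg]
    have hconst : HasFDerivAt (fun y => ‖r y‖ ^ 2) (0 : F →L[ℝ] ℝ) x := by
      refine (hasFDerivAt_const (1 : ℝ) x).congr_of_eventuallyEq ?_
      filter_upwards [isOpen_ball.mem_nhds hx] with y hy
      rw [hr_norm y (hUB hy), one_pow]
    have horth : ∀ v, inner ℝ (r x) ((1 + g' x) v) = 0 := fun v => by
      have h1 := congrArg (fun L : F →L[ℝ] ℝ => L v) (hrd.norm_sq.unique hconst)
      simpa [← mul_add, inner_add_right] using h1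
    by_contra hne
    obtain ⟨v, hv⟩ := ((1 + g' x).toContinuousLinearEquivOfDetNeZero hne).surjective (r x)
    have h2 := horth v
    have hv' : (1 + g' x) v = r x := by simpa using hv
    rw [hv', real_inner_self_eq_norm_sq, hr_norm x (hUB hx)] at h2
    norm_num at h2
  have h0 : volume.real U = 0 := by
    rw [← hvol, setIntegral_congr_fun measurableSet_ball hzero]
    simp
  have hUpos : 0 < volume U := measure_ball_pos volume 0 one_pos
  exact (ENNReal.toReal_pos hUpos.ne' measure_ball_lt_top.ne).ne' h0

/-- A bounded-by-`1/2` form of **Brouwer's fixed point theorem**. -/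
theorem exists_fixedPoint_of_norm_le_half {F : Type*} [NormedAddCommGroup F]
    [InnerProductSpace ℝ F] [FiniteDimensional ℝ F] {f : F → F} (hf : Continuous f)
    (hb : ∀ x, ‖f x‖ ≤ 1 / 2) : ∃ x, f x = x := by
  by_contra! hne
  -- An error below `‖x - f x‖` keeps `g` free of fixed points; an error below `1/2` keeps `‖g‖ <
  -- 1`.
  obtain ⟨g, hgc, hgf, -⟩ := hf.exists_contDiff_approx (ε := fun x => min ‖x - f x‖ (1 / 2)) 1
    (by fun_prop) fun x => lt_min (norm_pos_iff.2 (sub_ne_zero.2 (hne x).symm)) (by norm_num)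
  have hgne : ∀ x, x - g x ≠ 0 := fun x h => by
    have h1 := (hgf x).trans_le (min_le_left _ _)
    rw [← sub_eq_zero.1 h, dist_eq_norm] at h1
    exact lt_irrefl _ h1
  have hgb : ∀ x, ‖g x‖ < 1 := fun x => by
    have h1 := (hgf x).trans_le (min_le_right _ _)
    rw [dist_eq_norm] at h1
    have h2 := norm_add_le (g x - f x) (f x)
    rw [sub_add_cancel] at h2
    linarith [hb x]
  -- the ray from `g x` through `x` meets the sphere at `x + s x • (x - g x)`
  set p : F → ℝ := fun x => inner ℝ x (x - g x) with hp
  -- `D` is the reduced discriminant of `‖x + s (x - g x)‖² = 1` in `s`, and `s x` below is the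
  -- larger root.
  set D : F → ℝ := fun x => p x ^ 2 + ‖x - g x‖ ^ 2 * (1 - ‖x‖ ^ 2) with hD
  set s : F → ℝ := fun x => (√(D x) - p x) / ‖x - g x‖ ^ 2 with hs
  have hpos : ∀ x, 0 < ‖x - g x‖ ^ 2 := fun x => pow_pos (norm_pos_iff.2 (hgne x)) 2
  have hp_sphere : ∀ x : F, ‖x‖ = 1 → 0 < p x := fun x hx => by
    have h1 := real_inner_le_norm x (g x)
    rw [hx, one_mul] at h1
    simp only [hp, inner_sub_right, real_inner_self_eq_norm_sq, hx]
    linarith [hgb x]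
  have hDpos : ∀ x ∈ Metric.closedBall (0 : F) 1, 0 < D x := fun x hx => by
    rcases (mem_closedBall_zero_iff.1 hx).lt_or_eq with hlt | heq
    · have h1 : 0 < 1 - ‖x‖ ^ 2 := by nlinarith [norm_nonneg x]
      have := mul_pos (hpos x) h1
      simp only [hD]
      positivity
    · simp only [hD, heq]
      have := hp_sphere x heq
      norm_num
      positivity
  have hpc : ContDiff ℝ 1 p := contDiff_id.inner ℝ (contDiff_id.sub hgc)
  have hnc : ContDiff ℝ 1 fun x => ‖x - g x‖ ^ 2 := (contDiff_id.sub hgc).norm_sq ℝ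
  have hDc : ContDiff ℝ 1 D :=
    (hpc.pow 2).add (hnc.mul (contDiff_const.sub (contDiff_id.norm_sq ℝ)))
  refine not_exists_contDiff_retraction_sphere (fun x => x + s x • (x - g x))
    (fun x hx => ?_) (fun x hx => ?_) fun x hx => ?_
  · exact contDiffAt_id.add
      ((((hDc.contDiffAt.sqrt (hDpos x hx).ne').sub hpc.contDiffAt).div hnc.contDiffAt
        (hpos x).ne').smul (contDiff_id.sub hgc).contDiffAt)
  · have hsq : √(D x) ^ 2 = p x ^ 2 + ‖x - g x‖ ^ 2 * (1 - ‖x‖ ^ 2) := Real.sq_sqrt (hDpos x hx).le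
    have h1 : ‖x + s x • (x - g x)‖ ^ 2 = 1 := by
      rw [norm_add_sq_real, norm_smul, mul_pow, Real.norm_eq_abs, sq_abs, inner_smul_right]
      change ‖x‖ ^ 2 + 2 * (s x * p x) + s x ^ 2 * ‖x - g x‖ ^ 2 = 1
      simp only [hs]
      have h2 := (hpos x).ne'
      generalize ‖x - g x‖ ^ 2 = a at hsq h2 ⊢
      field_simp
      linear_combination hsq
    nlinarith [norm_nonneg (x + s x • (x - g x))]
  · have hx1 : ‖x‖ = 1 := by simpa using hx
    have h1 : s x = 0 := by
      simp only [hs, hD, hx1]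
      norm_num
      left
      rw [Real.sqrt_sq (hp_sphere x hx1).le, sub_self]
    simp [h1]

/-- **Brouwer's fixed point theorem** for bounded continuous maps. -/
theorem exists_fixedPoint_of_bounded {F : Type*} [NormedAddCommGroup F]
    [InnerProductSpace ℝ F] [FiniteDimensional ℝ F] {f : F → F} (hf : Continuous f) {R : ℝ}
    (hR : 0 < R) (hb : ∀ x, ‖f x‖ ≤ R) : ∃ x, f x = x := by
  obtain ⟨x, hx⟩ := exists_fixedPoint_of_norm_le_half
    (f := fun x => (2 * R)⁻¹ • f ((2 * R) • x)) (by fun_prop) fun x => by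
      rw [norm_smul, norm_inv, Real.norm_of_nonneg (by positivity), inv_mul_le_iff₀ (by positivity)]
      linarith [hb ((2 * R) • x)]
  refine ⟨(2 * R) • x, ?_⟩
  conv_rhs => rw [← hx]
  rw [smul_smul, mul_inv_cancel₀ (by positivity), one_smul]

/-! ### From Brouwer's theorem to Schauder's -/

/-- Take positive parts, with sum `S`; spread the missing mass `1 - S` evenly if `S < 1`, then
divide by `max 1 S`, which is the total in either case. -/
theorem exists_retraction_stdSimplex (ι : Type*) [Fintype ι] [Nonempty ι] :
    ∃ ρ : (ι → ℝ) → stdSimplex ℝ ι, Continuous ρ ∧ ∀ x : stdSimplex ℝ ι, ρ x = x := by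
  set S : (ι → ℝ) → ℝ := fun x => ∑ i, max (x i) 0 with hS
  set ρ : (ι → ℝ) → ι → ℝ := fun x i =>
    (max (x i) 0 + max (1 - S x) 0 / Fintype.card ι) / max 1 (S x) with hρ
  have hden : ∀ x, 0 < max 1 (S x) := fun x => zero_lt_one.trans_le (le_max_left _ _)
  have hcard : (Fintype.card ι : ℝ) ≠ 0 := by exact_mod_cast Fintype.card_ne_zero
  have hmem : ∀ x, ρ x ∈ stdSimplex ℝ ι := fun x => by
    refine ⟨fun i => by have := hden x; simp only [hρ]; positivity, ?_⟩
    simp only [hρ]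
    rw [← Finset.sum_div, div_eq_one_iff_eq (hden x).ne', Finset.sum_add_distrib, Finset.sum_const,
      Finset.card_univ, nsmul_eq_mul, mul_div_cancel₀ _ hcard]
    change S x + _ = _
    rcases le_total (S x) 1 with h | h
    · rw [max_eq_left (sub_nonneg.2 h), max_eq_left h]; ring
    · rw [max_eq_right (sub_nonpos.2 h), max_eq_right h]; ring
  refine ⟨fun x => ⟨ρ x, hmem x⟩, ?_, fun x => Subtype.ext (funext fun i => ?_)⟩
  · refine Continuous.subtype_mk (continuous_pi fun i => ?_) hmem
    have hSc : Continuous S := by fun_prop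
    exact (by fun_prop : Continuous fun x => max (x i) 0 + max (1 - S x) 0 / Fintype.card ι).div
      (by fun_prop) fun x => (hden x).ne'
  · have hS1 : S x = 1 := by
      simp only [hS]
      rw [← x.2.2]
      exact Finset.sum_congr rfl fun j _ => max_eq_left (x.2.1 j)
    simp only [hρ, hS1]
    have h0 : 0 ≤ x i := x.2.1 i
    change _ = x i
    simp [h0]

/-- **Brouwer's fixed point theorem** on the standard simplex. -/
theorem exists_fixedPoint_stdSimplex {ι : Type*} [Fintype ι] [Nonempty ι]
    {φ : stdSimplex ℝ ι → stdSimplex ℝ ι} (hφ : Continuous φ) : ∃ x, φ x = x := by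
  obtain ⟨ρ, hρc, hρ⟩ := exists_retraction_stdSimplex ι
  obtain ⟨x, hx⟩ := exists_fixedPoint_of_bounded
    (f := fun x : EuclideanSpace ℝ ι => WithLp.toLp 2 (φ (ρ (WithLp.ofLp x)) : ι → ℝ)) (R := 1)
    ((PiLp.continuous_toLp 2 _).comp (continuous_subtype_val.comp
      (hφ.comp (hρc.comp (PiLp.continuous_ofLp 2 _))))) one_pos fun x => by
      rw [EuclideanSpace.norm_eq]
      refine Real.sqrt_le_one.2 ?_
      set y := φ (ρ (WithLp.ofLp x))
      have hy : ∑ i, y i = 1 := y.2.2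
      rw [← hy]
      refine Finset.sum_le_sum fun i _ => ?_
      have h0 : 0 ≤ y i := y.2.1 i
      have h1 : y i ≤ 1 := by
        rw [← hy]
        exact Finset.single_le_sum (fun j _ => y.2.1 j) (Finset.mem_univ i)
      change ‖y i‖ ^ 2 ≤ _
      rw [Real.norm_of_nonneg h0]
      nlinarith
  refine ⟨φ (ρ (WithLp.ofLp x)), ?_⟩
  have h1 : ((φ (ρ (WithLp.ofLp x)) : stdSimplex ℝ ι) : ι → ℝ) = WithLp.ofLp x :=
    congrArg WithLp.ofLp hx
  have h2 : φ (ρ (WithLp.ofLp x)) = ρ (WithLp.ofLp x) := by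
    conv_lhs => rw [← hρ (φ (ρ (WithLp.ofLp x))), h1]
  rw [h2, h2]

/-- Schauder projection: bump functions around a finite `ε`-net of `K` replace `f` by a self-map of
the simplex of weights, to which Brouwer's theorem applies. -/
theorem exists_dist_le_of_isCompact_range {E : Type*} [NormedAddCommGroup E] [NormedSpace ℝ E]
    {C K : Set E} (hC : Convex ℝ C) (hne : C.Nonempty) (hK : IsCompact K) (hKC : K ⊆ C)
    {f : C → E} (hf : Continuous f) (hfK : ∀ x, f x ∈ K) {ε : ℝ} (hε : 0 < ε) :
    ∃ x : C, dist (f x) x ≤ ε := by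
  obtain ⟨t, htK, htf, hcov⟩ := hK.finite_cover_balls hε
  have : Fintype t := htf.fintype
  have hcov' : ∀ z ∈ K, ∃ y : t, dist z y < ε := fun z hz => by
    simpa using hcov hz
  obtain ⟨x₀, hx₀⟩ := hne
  have : Nonempty t := (hcov' _ (hfK ⟨x₀, hx₀⟩)).nonempty
  set μ : t → E → ℝ := fun y z => max (ε - dist z y) 0 with hμ
  have hμ0 : ∀ y z, 0 ≤ μ y z := fun y z => le_max_right _ _
  have hM : ∀ z ∈ K, 0 < ∑ y, μ y z := fun z hz => by
    obtain ⟨y, hy⟩ := hcov' z hz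
    exact Finset.sum_pos' (fun y _ => hμ0 y z)
      ⟨y, Finset.mem_univ y, lt_max_of_lt_left (sub_pos.2 hy)⟩
  set c : stdSimplex ℝ t → C := fun w => ⟨∑ y, w y • (y : E),
    hC.sum_mem (fun y _ => w.2.1 y) w.2.2 fun y _ => hKC (htK y.2)⟩ with hc
  have hcc : Continuous c := by
    refine Continuous.subtype_mk (continuous_finsetSum _ fun y _ => ?_) _
    exact ((continuous_apply y).comp continuous_subtype_val).smul continuous_const
  set φ : stdSimplex ℝ t → stdSimplex ℝ t := fun w =>
    ⟨fun y => μ y (f (c w)) / ∑ y', μ y' (f (c w)),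
      fun y => div_nonneg (hμ0 _ _) (hM _ (hfK _)).le, by
        rw [← Finset.sum_div, div_self (hM _ (hfK _)).ne']⟩ with hφ
  have hφc : Continuous φ := by
    have hμc : ∀ y, Continuous fun w => μ y (f (c w)) := fun y => by
      have := hf.comp hcc
      simp only [Function.comp_def] at this
      fun_prop
    refine Continuous.subtype_mk (continuous_pi fun y => ?_) _
    exact (hμc y).div (continuous_finsetSum _ fun y' _ => hμc y') fun w => (hM _ (hfK _)).ne'
  obtain ⟨w, hw⟩ := exists_fixedPoint_stdSimplex hφc
  refine ⟨c w, ?_⟩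
  set z := f (c w) with hz
  have hwy : ∀ y, w y = μ y z / ∑ y', μ y' z := fun y => by
    conv_lhs => rw [← hw]
    rfl
  have hw0 : ∀ y, 0 ≤ w y := w.2.1
  have hw1 : ∑ y, w y = 1 := w.2.2
  have hsum : z - (c w : E) = ∑ y, w y • (z - (y : E)) := by
    simp_rw [smul_sub]
    rw [Finset.sum_sub_distrib, ← Finset.sum_smul, hw1, one_smul]
  rw [dist_eq_norm, hsum]
  calc ‖∑ y, w y • (z - (y : E))‖ ≤ ∑ y, w y * ε := by
        refine norm_sum_le_of_le _ fun y _ => ?_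
        rw [norm_smul, Real.norm_of_nonneg (hw0 y), ← dist_eq_norm]
        -- Net points at distance at least `ε` from `z` carry zero weight.
        rcases le_total (dist z y) ε with h | h
        · exact mul_le_mul_of_nonneg_left h (hw0 y)
        · have h0 : w y = 0 := by
            rw [hwy, hμ]
            simp [max_eq_right (sub_nonpos.2 h)]
          simp [h0]
    _ = ε := by rw [← Finset.sum_mul, hw1, one_mul]

open Filter Topology in
/-- **Schauder's fixed point theorem**. -/
theorem exists_fixedPoint_of_isCompact_range {E : Type*} [NormedAddCommGroup E] [NormedSpace ℝ E]
    {C K : Set E} (hC : Convex ℝ C) (hne : C.Nonempty) (hK : IsCompact K) (hKC : K ⊆ C)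
    {f : C → E} (hf : Continuous f) (hfK : ∀ x, f x ∈ K) : ∃ x : C, f x = x := by
  choose x hx using fun n : ℕ => exists_dist_le_of_isCompact_range hC hne hK hKC hf hfK
    (Nat.one_div_pos_of_nat (α := ℝ) (n := n))
  obtain ⟨y, hy, ψ, hψ, hlim⟩ := hK.tendsto_subseq fun n => hfK (x n)
  have hdist : Tendsto (fun n => dist (f (x (ψ n))) (x (ψ n))) atTop (𝓝 0) :=
    squeeze_zero (fun _ => dist_nonneg) (fun n => hx (ψ n))
      (tendsto_one_div_add_atTop_nhds_zero_nat.comp hψ.tendsto_atTop)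
  have hxlim : Tendsto (fun n => (x (ψ n) : E)) atTop (𝓝 y) :=
    (tendsto_iff_of_dist hdist).1 hlim
  have hxlim' : Tendsto (fun n => x (ψ n)) atTop (𝓝 ⟨y, hKC hy⟩) :=
    tendsto_subtype_rng.2 hxlim
  exact ⟨⟨y, hKC hy⟩, tendsto_nhds_unique ((hf.tendsto _).comp hxlim') hlim⟩

/-! ### Fixed points, resolvents and eigenvectors in cones -/

namespace ProperCone

variable {E : Type*} [NormedAddCommGroup E] [NormedSpace ℝ E] {P : ProperCone ℝ E}

theorem continuousAdd_coe : ContinuousAdd P :=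
  ⟨(by fun_prop : Continuous fun z : P × P => (z.1 : E) + z.2).subtype_mk fun z =>
    (z.1 + z.2).2⟩

theorem isClosedEmbedding_coe : Topology.IsClosedEmbedding ((↑) : P → E) :=
  P.isClosed.isClosedEmbedding_subtypeVal

theorem norm_coe_smul (r : {r : ℝ // 0 ≤ r}) (x : P) :
    ‖((r • x : P) : E)‖ = (r : ℝ) * ‖(x : E)‖ := by
  change ‖(r : ℝ) • (x : E)‖ = _
  rw [norm_smul, Real.norm_of_nonneg r.2]

theorem eq_zero_of_add_eq_zero (hP : (P : ConvexCone ℝ E).Salient) {x y : E} (hx : x ∈ P)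
    (hy : y ∈ P) (h : x + y = 0) : x = 0 := by
  by_contra hne
  exact hP x hx hne (by rwa [← eq_neg_of_add_eq_zero_right h])

/-- Schauder's theorem for maps of a cone which send a ball of the cone to itself. -/
theorem exists_fixedPoint {F : P → P} (hF : Continuous F) {K : Set P} (hK : IsCompact K) {r : ℝ}
    (hr : 0 ≤ r) (h : ∀ x : P, ‖(x : E)‖ ≤ r → F x ∈ K ∧ ‖(F x : E)‖ ≤ r) :
    ∃ x : P, ‖(x : E)‖ ≤ r ∧ F x = x := by
  have hC : Convex ℝ ((P : Set E) ∩ Metric.closedBall 0 r) :=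
    (P : ConvexCone ℝ E).convex.inter (convex_closedBall 0 r)
  have hmem : ∀ x : P, x ∈ K ∧ ‖(x : E)‖ ≤ r →
      (x : E) ∈ ((↑) : P → E) '' K ∩ Metric.closedBall 0 r := fun x hx =>
    ⟨⟨x, hx.1, rfl⟩, mem_closedBall_zero_iff.2 hx.2⟩
  obtain ⟨x, hx⟩ := exists_fixedPoint_of_isCompact_range hC
    ⟨0, P.zero_mem, by simpa using hr⟩
    ((hK.image continuous_subtype_val).inter_right Metric.isClosed_closedBall)
    (Set.inter_subset_inter_left _ (by rintro _ ⟨x, -, rfl⟩; exact x.2))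
    (f := fun x => (F ⟨x, x.2.1⟩ : E))
    (continuous_subtype_val.comp (hF.comp (continuous_subtype_val.subtype_mk _)))
    fun x => hmem _ (h ⟨x, x.2.1⟩ (mem_closedBall_zero_iff.1 x.2.2))
  exact ⟨⟨x, x.2.1⟩, mem_closedBall_zero_iff.1 x.2.2, Subtype.ext hx⟩

/-- The Neumann series of a contractive additive map of a cone. -/
theorem exists_resolvent [CompleteSpace E] (L : P →+ P) (hL : Continuous L) {q : ℝ}
    (hq0 : 0 ≤ q) (hq : q < 1) (hLq : ∀ x, ‖(L x : E)‖ ≤ q * ‖(x : E)‖) :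
    ∃ S : P → P, Continuous S ∧ ∀ x, S x = x + L (S x) := by
  have := continuousAdd_coe (P := P)
  have hbound : ∀ n (x : P), ‖(L^[n] x : E)‖ ≤ q ^ n * ‖(x : E)‖ := by
    intro n x
    induction n with
    | zero => simp
    | succ n ih =>
      rw [Function.iterate_succ_apply', pow_succ', mul_assoc]
      exact (hLq _).trans (by gcongr)
  have hsum : ∀ x : P, Summable fun n => (L^[n] x : E) := fun x =>
    Summable.of_norm_bounded ((summable_geometric_of_lt_one hq0 hq).mul_right _)
      fun n => hbound n x
  have hmem : ∀ x : P, ∑' n, (L^[n] x : E) ∈ P := fun x =>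
    P.isClosed.mem_of_tendsto (hsum x).hasSum.tendsto_sum_nat
      (Filter.Eventually.of_forall fun n => sum_mem fun i _ => (L^[i] x).2)
  refine ⟨fun x => ⟨_, hmem x⟩, Continuous.subtype_mk ?_ hmem, fun x => ?_⟩
  · refine continuous_iff_continuousAt.2 fun x => ?_
    -- The geometric bound is uniform only on bounded sets, so continuity is checked locally.
    have hopen : IsOpen {y : P | ‖(y : E)‖ < ‖(x : E)‖ + 1} :=
      isOpen_lt (by fun_prop) continuous_const
    refine ContinuousOn.continuousAt (continuousOn_tsum (u := fun n => q ^ n * (‖(x : E)‖ + 1))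
      (fun n => (continuous_subtype_val.comp (hL.iterate n)).continuousOn)
      ((summable_geometric_of_lt_one hq0 hq).mul_right _) fun n y hy => ?_)
      (hopen.mem_nhds (show ‖(x : E)‖ < ‖(x : E)‖ + 1 from lt_add_one _))
    exact (hbound n y).trans (mul_le_mul_of_nonneg_left (le_of_lt hy) (pow_nonneg hq0 n))
  · set y : P := ⟨_, hmem x⟩ with hy
    have hS : HasSum (fun n => L^[n] x) y :=
      (Topology.IsInducing.hasSum_iff (g := (AddSubmonoidClass.subtype P : P →+ E))
        Topology.IsInducing.subtypeVal (fun n => L^[n] x) y).1 (hsum x).hasSum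
    have hLS : HasSum (fun n => L^[n + 1] x) (L y) := by
      simp_rw [Function.iterate_succ_apply']
      exact hS.map L hL
    have h := hS.unique (HasSum.zero_add (f := fun n => L^[n] x) hLS)
    rwa [Function.iterate_zero_apply] at h

/-- A compact map of a salient cone into itself which does not degenerate on the unit sphere has
an eigenvector there. -/
theorem exists_eigenvector (hP : (P : ConvexCone ℝ E).Salient) (hne : ∃ x ∈ P, x ≠ 0)
    {N : P → P} (hN : Continuous N) {K : Set P} (hK : IsCompact K)
    (hNK : ∀ x : P, ‖(x : E)‖ ≤ 1 → N x ∈ K) {c : ℝ} (hc : 0 < c)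
    (hNc : ∀ x : P, c * ‖(x : E)‖ ^ 2 ≤ ‖(N x : E)‖) :
    ∃ x : P, ‖(x : E)‖ = 1 ∧ (N x : E) = ‖(N x : E)‖ • (x : E) := by
  obtain ⟨p, hpP, hp⟩ := hne
  -- `N` may vanish inside the ball, so it cannot be normalised directly. The term `φ x • p` keeps
  -- `G` nonzero there and disappears on the unit sphere, where `T` takes its values.
  set φ : P → ℝ := fun x => max (1 - ‖(x : E)‖) 0 with hφ
  have hφ0 : ∀ x, 0 ≤ φ x := fun x => le_max_right _ _
  have hφc : Continuous φ := by fun_prop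
  set G : P → E := fun x => N x + φ x • p with hG
  have hφp : ∀ x, φ x • p ∈ P := fun x => ((⟨φ x, hφ0 x⟩ : {r : ℝ // 0 ≤ r}) • (⟨p, hpP⟩ : P) : P).2
  have hGP : ∀ x, G x ∈ P := fun x => add_mem (N x).2 (hφp x)
  have hnz : ∀ (y : P) (s : ℝ), 0 ≤ s → (s = 0 → (y : E) ≠ 0) → (y : E) + s • p ≠ 0 := by
    intro y s hs hy h0
    have hsP : s • p ∈ P := ((⟨s, hs⟩ : {r : ℝ // 0 ≤ r}) • (⟨p, hpP⟩ : P) : P).2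
    have h1 := eq_zero_of_add_eq_zero hP y.2 hsP h0
    rw [h1, zero_add] at h0
    exact hy ((smul_eq_zero.1 h0).resolve_right hp) h1
  have hG0 : ∀ x, G x ≠ 0 := fun x => hnz _ _ (hφ0 x) fun h => by
    have h1 : 1 ≤ ‖(x : E)‖ := by
      have := (le_max_left (1 - ‖(x : E)‖) 0).trans_eq h
      linarith
    refine norm_pos_iff.1 (lt_of_lt_of_le ?_ (hNc x))
    positivity
  have hGc : Continuous G :=
    (continuous_subtype_val.comp hN).add (hφc.smul continuous_const)
  have hTP : ∀ x, ‖G x‖⁻¹ • G x ∈ P := fun x =>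
    ((⟨‖G x‖⁻¹, by positivity⟩ : {r : ℝ // 0 ≤ r}) • (⟨G x, hGP x⟩ : P) : P).2
  set T : P → P := fun x => ⟨‖G x‖⁻¹ • G x, hTP x⟩ with hT
  have hTc : Continuous T :=
    ((hGc.norm.inv₀ fun x => norm_ne_zero_iff.2 (hG0 x)).smul hGc).subtype_mk hTP
  have hT1 : ∀ x, ‖(T x : E)‖ = 1 := fun x => norm_smul_inv_norm (𝕜 := ℝ) (hG0 x)
  -- the values of `T` on the unit ball lie in the image of a compact set
  set D : Set (P × ℝ) :=
    (K ×ˢ Set.Icc (0 : ℝ) 1) ∩ {z | c * (1 - z.2) ^ 2 ≤ ‖(z.1 : E)‖} with hD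
  have hDc : IsCompact D :=
    (hK.prod isCompact_Icc).inter_right (isClosed_le (by fun_prop) (by fun_prop))
  have hadd : Continuous fun z : P × ℝ => (z.1 : E) + z.2 • p := by fun_prop
  -- At `z.2 = 0` the constraint in `D` reads `c ≤ ‖z.1‖`; otherwise salience excludes cancellation
  -- with `p`.
  have hDnz : ∀ z ∈ D, (z.1 : E) + z.2 • p ≠ 0 := fun z hz => hnz _ _ hz.1.2.1 fun h => by
    have h1 : c * (1 - z.2) ^ 2 ≤ ‖(z.1 : E)‖ := hz.2
    rw [h] at h1
    exact norm_pos_iff.1 (lt_of_lt_of_le (by norm_num; exact hc) h1)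
  have hcomp := (isClosedEmbedding_coe (P := P)).isCompact_preimage (hDc.image_of_continuousOn
    (f := fun z : P × ℝ => ‖(z.1 : E) + z.2 • p‖⁻¹ • ((z.1 : E) + z.2 • p))
    ((hadd.continuousOn.norm.inv₀ fun z hz => norm_ne_zero_iff.2 (hDnz z hz)).smul
      hadd.continuousOn))
  obtain ⟨x, hx1, hx⟩ := exists_fixedPoint hTc hcomp zero_le_one fun x hx => by
    refine ⟨⟨(N x, φ x), ⟨⟨hNK x hx, hφ0 x, ?_⟩, ?_⟩, rfl⟩, (hT1 x).le⟩
    · exact max_le (by linarith [norm_nonneg (x : E)]) zero_le_one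
    · have : φ x = 1 - ‖(x : E)‖ := max_eq_left (by linarith)
      change c * (1 - φ x) ^ 2 ≤ ‖(N x : E)‖
      rw [this, sub_sub_cancel]
      exact hNc x
  have hnorm : ‖(x : E)‖ = 1 := by rw [← hT1 x, hx]
  have hGN : G x = N x := by simp [hG, hφ, hnorm]
  refine ⟨x, hnorm, ?_⟩
  have h1 : ‖G x‖⁻¹ • G x = (x : E) := congrArg Subtype.val hx
  rw [← hGN]
  conv_rhs => rw [← h1]
  rw [smul_inv_smul₀ (norm_ne_zero_iff.2 (hG0 x))]

end ProperCone

/-! ### Bounds for the form and the homogeneous equation -/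

namespace ConeBilinForm

variable {E : Type*} [NormedAddCommGroup E] [NormedSpace ℝ E] {P : ProperCone ℝ E}
  {b : ConeBilinForm P}

theorem IsCompactForm.exists_isCompact (hb : b.IsCompactForm) (r : ℝ) :
    ∃ K : Set P, IsCompact K ∧ ∀ u v : P, ‖(u : E)‖ ≤ r → ‖(v : E)‖ ≤ r → b u v ∈ K := by
  have hbdd : Bornology.IsBounded {z : P × P | ‖(z.1 : E)‖ ≤ r ∧ ‖(z.2 : E)‖ ≤ r} := by
    refine (Metric.isBounded_closedBall (x := (0 : P × P)) (r := r)).subset fun z hz => ?_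
    rw [Metric.mem_closedBall, Prod.dist_eq, Subtype.dist_eq, Subtype.dist_eq]
    exact max_le (by simpa using hz.1) (by simpa using hz.2)
  exact ⟨_, ProperCone.isClosedEmbedding_coe.isCompact_preimage (hb.2 _ hbdd),
    fun u v hu hv => subset_closure ⟨(u, v), ⟨hu, hv⟩, rfl⟩⟩

theorem norm_apply_smul_smul (r s : {r : ℝ // 0 ≤ r}) (u v : P) :
    ‖(b (r • u) (s • v) : E)‖ = r * s * ‖(b u v : E)‖ := by
  rw [map_smul, map_smul, LinearMap.smul_apply, ProperCone.norm_coe_smul,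
    ProperCone.norm_coe_smul]
  ring

/-- A nonzero element of a cone is a positive multiple of a unit vector. -/
theorem exists_unit (u : P) (hu : (u : E) ≠ 0) :
    ∃ u' : P, ‖(u' : E)‖ = 1 ∧ (⟨‖(u : E)‖, norm_nonneg _⟩ : {r : ℝ // 0 ≤ r}) • u' = u := by
  refine ⟨(⟨‖(u : E)‖⁻¹, by positivity⟩ : {r : ℝ // 0 ≤ r}) • u, ?_, Subtype.ext ?_⟩
  · rw [ProperCone.norm_coe_smul]
    exact inv_mul_cancel₀ (norm_ne_zero_iff.2 hu)
  · exact smul_inv_smul₀ (norm_ne_zero_iff.2 hu) (u : E)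

/-- Compactness bounds `b` on pairs of unit vectors and homogeneity does the rest; this makes the
set defining `formNorm` nonempty. -/
theorem IsCompactForm.exists_bound (hb : b.IsCompactForm) :
    ∃ B : ℝ, 0 ≤ B ∧ ∀ u v : P, ‖(b u v : E)‖ ≤ B * ‖(u : E)‖ * ‖(v : E)‖ := by
  obtain ⟨K, hK, hbK⟩ := hb.exists_isCompact 1
  obtain ⟨M, hM⟩ := hK.exists_bound_of_continuousOn
    (continuous_subtype_val : Continuous ((↑) : P → E)).continuousOn
  refine ⟨M, (norm_nonneg _).trans (hM _ (hbK 0 0 (by simp) (by simp))), fun u v => ?_⟩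
  by_cases hu : (u : E) = 0
  · have : u = 0 := Subtype.ext hu
    simp [this]
  by_cases hv : (v : E) = 0
  · have : v = 0 := Subtype.ext hv
    simp [this]
  obtain ⟨u', hu', hu''⟩ := exists_unit u hu
  obtain ⟨v', hv', hv''⟩ := exists_unit v hv
  conv_lhs => rw [← hu'', ← hv'']
  rw [norm_apply_smul_smul]
  have := hM _ (hbK u' v' hu'.le hv'.le)
  calc ‖(u : E)‖ * ‖(v : E)‖ * ‖(b u' v' : E)‖ ≤ ‖(u : E)‖ * ‖(v : E)‖ * M := by gcongr
    _ = M * ‖(u : E)‖ * ‖(v : E)‖ := by ring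

theorem formNorm_nonneg : 0 ≤ b.formNorm :=
  Real.sInf_nonneg fun _ hB => hB.1

theorem IsCompactForm.norm_apply_le (hb : b.IsCompactForm) (u v : P) :
    ‖(b u v : E)‖ ≤ b.formNorm * ‖(u : E)‖ * ‖(v : E)‖ := by
  obtain ⟨B, hB⟩ := hb.exists_bound
  rcases (mul_nonneg (norm_nonneg (u : E)) (norm_nonneg (v : E))).eq_or_lt with h | h
  · have := hB.2 u v
    rw [mul_assoc, ← h, mul_zero] at this
    rwa [mul_assoc, ← h, mul_zero]
  · rw [mul_assoc, ← div_le_iff₀ h]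
    refine le_csInf ⟨B, hB⟩ fun B' hB' => ?_
    rw [div_le_iff₀ h, ← mul_assoc]
    exact hB'.2 u v

theorem IsCoerciveForm.exists_le (hb : b.IsCoerciveForm) :
    ∃ c : ℝ, 0 < c ∧ ∀ u : P, c * ‖(u : E)‖ ^ 2 ≤ ‖(b u u : E)‖ := by
  refine ⟨_, hb, fun u => ?_⟩
  by_cases hu : (u : E) = 0
  · simp [hu]
  obtain ⟨u', hu', hu''⟩ := exists_unit u hu
  have h1 : sInf ((fun u : P => ‖(b u u : E)‖) '' {u : P | ‖(u : E)‖ = 1}) ≤ ‖(b u' u' : E)‖ :=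
    csInf_le ⟨0, by rintro _ ⟨x, -, rfl⟩; exact norm_nonneg _⟩ ⟨u', hu', rfl⟩
  conv_rhs => rw [← hu'']
  rw [norm_apply_smul_smul, mul_comm, sq]
  gcongr

/-- A nonzero solution of `w = L w + b(w, w)` for a contractive `L`. -/
theorem exists_ne_zero_eq_map_add [CompleteSpace E] (hP : (P : ConvexCone ℝ E).Salient)
    (hne : ∃ x ∈ P, x ≠ 0) (hb : b.IsCompactForm) (hcoer : b.IsCoerciveForm)
    (L : P →ₗ[{r : ℝ // 0 ≤ r}] P) (hL : Continuous L) {q : ℝ} (hq0 : 0 ≤ q) (hq : q < 1)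
    (hLq : ∀ x, ‖(L x : E)‖ ≤ q * ‖(x : E)‖) :
    ∃ w : P, w ≠ 0 ∧ w = L w + b w w := by
  obtain ⟨S, hS, hSL⟩ := ProperCone.exists_resolvent L.toAddMonoidHom hL hq0 hq hLq
  replace hSL : ∀ x, S x = x + L (S x) := hSL
  obtain ⟨c, hc, hbc⟩ := hcoer.exists_le
  obtain ⟨K, hK, hbK⟩ := hb.exists_isCompact 1
  -- With `y = S (b x x)`, `b x x = y - L y` has norm at most `(1 + q) ‖y‖`, so coercivity passes to
  -- `S ∘ b`.
  have hlow : ∀ x : P, c / (1 + q) * ‖(x : E)‖ ^ 2 ≤ ‖(S (b x x) : E)‖ := fun x => by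
    rw [div_mul_eq_mul_div, div_le_iff₀ (by positivity)]
    refine (hbc x).trans ?_
    have h1 : (b x x : E) = S (b x x) - L (S (b x x)) :=
      eq_sub_of_add_eq (congrArg Subtype.val (hSL (b x x))).symm
    calc ‖(b x x : E)‖ ≤ ‖(S (b x x) : E)‖ + ‖(L (S (b x x)) : E)‖ := by
          rw [h1]; exact norm_sub_le _ _
      _ ≤ ‖(S (b x x) : E)‖ + q * ‖(S (b x x) : E)‖ := by gcongr; exact hLq _
      _ = ‖(S (b x x) : E)‖ * (1 + q) := by ring
  obtain ⟨x, hx1, hx⟩ := ProperCone.exists_eigenvector hP hne (N := fun x => S (b x x))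
    (hS.comp (hb.1.comp (continuous_id.prodMk continuous_id))) (hK.image hS)
    (fun x hx => ⟨_, hbK x x hx hx, rfl⟩) (by positivity) hlow
  set n : ℝ := ‖(S (b x x) : E)‖ with hn
  have hn0 : 0 < n := lt_of_lt_of_le (by rw [hx1]; positivity) (hlow x)
  let ν : {r : ℝ // 0 ≤ r} := ⟨n, hn0.le⟩
  let κ : {r : ℝ // 0 ≤ r} := ⟨n⁻¹, by positivity⟩
  have hκν : κ * ν = 1 := Subtype.ext (inv_mul_cancel₀ hn0.ne')
  have hSx : S (b x x) = ν • x := Subtype.ext hx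
  refine ⟨κ • x, fun h => ?_, ?_⟩
  · have h1 := congrArg (fun y : P => ‖(y : E)‖) h
    simp only [ProperCone.norm_coe_smul, hx1, mul_one] at h1
    have h2 : n⁻¹ = 0 := by simpa [κ] using h1
    exact hn0.ne' (inv_eq_zero.1 h2)
  · have h1 := hSL (b x x)
    rw [hSx, map_smul] at h1
    -- Scaling by `κ²` turns `ν x = b(x,x) + L(ν x)` into the equation for `κ x`, because `κ ν = 1`
    -- and `b` is quadratic on the diagonal.
    have h2 := congrArg (fun y => (κ * κ) • y) h1
    simp only [smul_add, smul_smul, mul_assoc, hκν, mul_one] at h2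
    refine h2.trans ?_
    rw [map_smul, map_smul, map_smul, LinearMap.smul_apply, smul_smul, add_comm]

end ConeBilinForm

/-! ### The two solutions -/

theorem theorem2p2 {E : Type*} [NormedAddCommGroup E] [NormedSpace ℝ E] [CompleteSpace E]
    (P : ProperCone ℝ E) (hPsalient : (P : ConvexCone ℝ E).Salient) (hPne : ∃ x ∈ P, x ≠ 0)
    (b : ConeBilinForm P) (hcompact : b.IsCompactForm) (hcoercive : b.IsCoerciveForm)
    (u₀ : P) (hu₀ : 4 * b.formNorm * ‖(u₀ : E)‖ < 1) :
    ∃ u v : P, u ≠ v ∧ u = b u u + u₀ ∧ v = b v v + u₀ := by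
  have := ProperCone.continuousAdd_coe (P := P)
  have hβ := b.formNorm_nonneg
  have hle := hcompact.norm_apply_le
  have h0 := norm_nonneg (u₀ : E)
  -- a solution in the ball of radius `2 ‖u₀‖`
  obtain ⟨K, hK, hbK⟩ := hcompact.exists_isCompact (2 * ‖(u₀ : E)‖)
  have hadd : Continuous fun x : P => x + u₀ := by fun_prop
  obtain ⟨v, hv, hvv⟩ := ProperCone.exists_fixedPoint (F := fun u => b u u + u₀)
    (hadd.comp (hcompact.1.comp (continuous_id.prodMk continuous_id))) (hK.image hadd)
    (r := 2 * ‖(u₀ : E)‖) (by positivity) fun x hx => by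
      refine ⟨⟨_, hbK x x hx hx, rfl⟩, ?_⟩
      calc ‖((b x x + u₀ : P) : E)‖ ≤ ‖(b x x : E)‖ + ‖(u₀ : E)‖ := norm_add_le _ _
        _ ≤ b.formNorm * (2 * ‖(u₀ : E)‖) * (2 * ‖(u₀ : E)‖) + ‖(u₀ : E)‖ := by
            gcongr
            exact (hle x x).trans (by gcongr)
        _ = 4 * b.formNorm * ‖(u₀ : E)‖ * ‖(u₀ : E)‖ + ‖(u₀ : E)‖ := by ring
        _ ≤ 1 * ‖(u₀ : E)‖ + ‖(u₀ : E)‖ := by gcongr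
        _ = 2 * ‖(u₀ : E)‖ := by ring
  -- the equation for the increment `w` of a further solution `v + w`
  obtain ⟨w, hw0, hw⟩ := ConeBilinForm.exists_ne_zero_eq_map_add hPsalient hPne hcompact hcoercive
    (b v + b.flip v)
    (((hcompact.1.comp (continuous_const.prodMk continuous_id)).add
      (hcompact.1.comp (continuous_id.prodMk continuous_const)) :
        Continuous fun x => b v x + b x v))
    -- Each of the two cross terms contributes `|b| ‖v‖`, and `‖v‖ ≤ 2 ‖u₀‖`.
    (q := 4 * b.formNorm * ‖(u₀ : E)‖) (by positivity) hu₀ fun x => by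
      calc ‖((b v x + b x v : P) : E)‖ ≤ ‖(b v x : E)‖ + ‖(b x v : E)‖ := norm_add_le _ _
        _ ≤ b.formNorm * ‖(v : E)‖ * ‖(x : E)‖ + b.formNorm * ‖(x : E)‖ * ‖(v : E)‖ :=
            add_le_add (hle v x) (hle x v)
        _ = 2 * b.formNorm * ‖(v : E)‖ * ‖(x : E)‖ := by ring
        _ ≤ 2 * b.formNorm * (2 * ‖(u₀ : E)‖) * ‖(x : E)‖ := by gcongr
        _ = 4 * b.formNorm * ‖(u₀ : E)‖ * ‖(x : E)‖ := by ring
  replace hw : w = b v w + b w v + b w w := hw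
  replace hvv : b v v + u₀ = v := hvv
  refine ⟨v + w, v, fun h => hw0 (by simpa using h), ?_, hvv.symm⟩
  calc v + w = (b v v + u₀) + (b v w + b w v + b w w) := by rw [hvv, ← hw]
    _ = b (v + w) (v + w) + u₀ := by
        simp only [map_add, LinearMap.add_apply]
        abel
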